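/- Let $p$ be an odd prime, $K=\mathbb{Q}(\zeta_p)$, $K^+$ its maximal real subfield, and suppose that $p$ does not divide the class number of $K^+$. Let $\pi=(\zeta_p-1)$ be the prime ideal of $\mathbb{Z}[\zeta_p]$ above $p$, let $v$ be a primitive root modulo $p$, and let $\sigma\in\mathrm{Gal}(K/\mathbb{Q})$ be given by $\sigma(\zeta_p)=\zeta_p^{v}$. For $i\in\mathbb{Z}$ let $v^{(i)}$ be the integer with $1\le v^{(i)}\le p-1$ and $v^{(i)}\equiv v^{i}\pmod p$, and put $P(\sigma)=\sum_{i=0}^{p-2}v^{(-i)}\sigma^{i}\in\mathbb{Z}[\mathrm{Gal}(K/\mathbb{Q})]$, so that $A^{P(\sigma)}=\prod_{i=0}^{p-2}\sigma^{i}(A)^{v^{(-i)}}$. Let $m$ be an integer with $1\le m\le\frac{p-3}{2}$, let $\mu\in\mathbb{F}_p^*$ be the class of $v^{2m+1}$, and let $\Gamma$ be a subgroup of order $p$ of the ideal class group of $K$ annihilated by $\sigma-\mu$, i.e. $\sigma(c)=c^{\mu}$ for all $c\in\Gamma$ (so $p$ is irregular). Let $\mathbf{q}$ be a prime ideal of $\mathbb{Z}[\zeta_p]$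 of inertial degree $1$ whose class lies in $\Gamma$. Let $A\in\mathbb{Z}[\zeta_p]$ be singular (that is, $A$ is not a $p$-th power in $K$ and $A\,\mathbb{Z}[\zeta_p]$ is the $p$-th power of an ideal) with $A\,\mathbb{Z}[\zeta_p]=\mathbf{q}^{p}$, with $\pi^{2m+1}\,\|\,A-1$ (so $A$ is not primary, i.e. not congruent to a $p$-th power modulo $\pi^p$), and with $A\overline{A}=D^{p}$ for some integer $D$ of $K^+$. Then $$A^{P(\sigma)}\equiv 1\pmod{\pi^{2(p-1)}}.$$ -/

import Mathlib

open NumberField nonZeroDivisors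

noncomputable section

/-- The prime `π = (ζ - 1)` of `ℤ[ζ]` above `p`, for a primitive `p`-th root of unity `ζ`. -/
def cycloPi {p : ℕ} [Fact p.Prime] {K : Type*} [Field K] [NumberField K] {ζ : K}
    (hζ : IsPrimitiveRoot ζ p) : Ideal (𝓞 K) :=
  haveI : NeZero p := ⟨(Fact.out : p.Prime).ne_zero⟩
  Ideal.span {hζ.toInteger - 1}

/-- An integer `A` is singular if it is not a `p`-th power in `K` and generates the `p`-th power
of an ideal. -/
def IsSingular (p : ℕ) {K : Type*} [Field K] (A : 𝓞 K) : Prop :=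
  (¬ ∃ b : K, b ^ p = (A : K)) ∧ ∃ 𝔞 : Ideal (𝓞 K), Ideal.span {A} = 𝔞 ^ p

/-- The action of a Galois automorphism on the ideal class group. -/
def classAct {K : Type*} [Field K] [NumberField K] (σ : Gal(K/ℚ)) :
    ClassGroup (𝓞 K) ≃* ClassGroup (𝓞 K) :=
  ClassGroup.mulEquiv (RingOfIntegers.mapRingEquiv σ.toRingEquiv)

/-- `Γ` is annihilated by `σ - μ`, where `μ ∈ 𝔽_p^*`. For a group `Γ` of exponent `p`, the choice
of the representative of `μ` does not matter. -/
def AnnihilatedBySub {p : ℕ} {K : Type*} [Field K] [NumberField K]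
    (Γ : Subgroup (ClassGroup (𝓞 K))) (σ : Gal(K/ℚ)) (μ : (ZMod p)ˣ) : Prop :=
  ∀ c ∈ Γ, classAct σ c = c ^ (μ : ZMod p).val

/-- `A ^ P(σ)` for `P(σ) = ∑_{i=0}^{p-2} v^{-i} σ^i`, where `v^{-i}` stands for
its representative modulo `p` between `1` and `p - 1`. -/
def powP (p : ℕ) [Fact p.Prime] (v : ℕ) {K : Type*} [Field K] [NumberField K]
    (σ : Gal(K/ℚ)) (A : 𝓞 K) : 𝓞 K :=
  ∏ i ∈ Finset.range (p - 1), ((σ ^ i) • A) ^ ((v : ZMod p) ^ (-(i : ℤ))).val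

end

/-! The proof compares `A ^ P(σ)` with the `p`-th power of a Gauss sum. Let `l` be the norm of `𝔮`,
`χ` the inverse `p`-th power residue character modulo `𝔮`, `g` its Gauss sum and `G = g ^ p`, an
element of `ℤ[ζ]`.

One half of Stickelberger's theorem (`map_jacobiProd_mem_ker_pow`, `powP_dvd_pow`) shows that `A ^
P(σ)` divides `G ^ p`; let `u` be the quotient. Since `G * conj G = l ^ p` (`jacobiProd_mul_map`)
and `A * conj A = D ^ p` (`powP_mul_conj_sq`), `A ^ P(σ)` and `G ^ p` have the same absolute value
at every complex embedding. By Kronecker, `u` is a root of unity.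

Congruences then determine `u`. As `g ≡ -1` modulo `π`, also `G ≡ -1` modulo `π ^ p`
(`sub_one_pow_dvd_jacobiProd_add_one`), so `G ^ p ≡ -1` modulo `π ^ (2p - 1)`. Already modulo `π ^
2` this forces `u = -1`, hence `A ^ P(σ) = -G ^ p`. -/

/-! ### Congruences of `p`-th powers and a count of residues -/

/-- In the expansion of `(-1 + ϖ ^ n * y) ^ p` the middle terms gain a factor `p`, and the last has
`n * p ≥ n + (p - 1)` factors `ϖ`. Used with `n = 1` for the Gauss sum and `n = p` for `G`. -/
theorem dvd_pow_prime_add_one {R : Type*} [CommRing R] {p : ℕ} (hp : p.Prime) (hodd : Odd p)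
    {ϖ x : R} {n : ℕ} (hn : 1 ≤ n) (hϖ : ϖ ^ (p - 1) ∣ (p : R)) (h : ϖ ^ n ∣ x + 1) :
    ϖ ^ (n + (p - 1)) ∣ x ^ p + 1 := by
  obtain ⟨y, hy⟩ := h
  obtain ⟨z, hz⟩ := hϖ
  obtain ⟨r, hr⟩ := exists_add_pow_prime_eq hp (-1 : R) (ϖ ^ n * y)
  have hx : x = -1 + ϖ ^ n * y := by linear_combination hy
  have h1 : ϖ ^ (n + (p - 1)) ∣ (ϖ ^ n * y) ^ p := by
    rw [mul_pow, ← pow_mul]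
    refine Dvd.dvd.mul_right (pow_dvd_pow _ ?_) _
    obtain ⟨q, rfl⟩ : ∃ q, p = q + 1 := ⟨p - 1, by have := hp.pos; omega⟩
    simp only [Nat.add_sub_cancel]
    nlinarith
  have h2 : x ^ p + 1 = (ϖ ^ n * y) ^ p + ϖ ^ (n + (p - 1)) * (-(z * y * r)) := by
    rw [hx, hr, hodd.neg_one_pow, hz, pow_add]
    ring
  rw [h2]
  exact dvd_add h1 (Dvd.intro _ rfl)

/-- Each residue `r` strictly between `p - t` and `p` is hit by `j = t⁻¹ r`. Here `j` is neither `0`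
nor `p - 1`, because `r` is neither `0` nor `-t`. -/
theorem le_card_filter_lt_val_add_val {p : ℕ} [Fact p.Prime] {t : ZMod p} (ht : t ≠ 0) :
    t.val - 1 ≤ ((Finset.Ico 1 (p - 1)).filter fun j : ℕ => p < t.val + (t * j).val).card := by
  have hp : p.Prime := Fact.out
  have htp := t.val_lt
  have hcard : (Finset.Ioo (p - t.val) p).card = t.val - 1 := by
    rw [Nat.card_Ioo]; omega
  rw [← hcard]
  have key (r : ℕ) (hr : r < p) : t * ((t⁻¹ * (r : ZMod p)).val : ZMod p) = r := by
    rw [ZMod.natCast_zmod_val, mul_inv_cancel_left₀ ht]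
  refine Finset.card_le_card_of_injOn (fun r : ℕ => (t⁻¹ * (r : ZMod p)).val) ?_ ?_
  · intro r hr
    simp only [Finset.coe_Ioo, Set.mem_Ioo] at hr
    simp only [Finset.coe_filter, Finset.mem_Ico, Set.mem_ofPred_eq]
    have hk := key r hr.2
    have hlt := (t⁻¹ * (r : ZMod p)).val_lt
    rw [hk, ZMod.val_cast_of_lt hr.2]
    refine ⟨⟨?_, ?_⟩, by omega⟩
    · rw [Nat.one_le_iff_ne_zero]
      intro h0
      rw [h0, Nat.cast_zero, mul_zero] at hk
      have := congrArg ZMod.val hk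
      rw [ZMod.val_cast_of_lt hr.2, ZMod.val_zero] at this
      omega
    · by_contra hge
      have h1 : (t⁻¹ * (r : ZMod p)).val = p - 1 := by omega
      rw [h1, Nat.cast_sub hp.one_le, ZMod.natCast_self] at hk
      have h2 : ((r + t.val : ℕ) : ZMod p) = 0 := by
        rw [Nat.cast_add, ← hk, ZMod.natCast_zmod_val]; simp
      rw [ZMod.natCast_eq_zero_iff] at h2
      have := Nat.le_of_dvd (by omega) h2
      obtain ⟨c, hc⟩ := h2
      have : c < 2 := by nlinarith
      have : c = 1 := by nlinarith
      subst this
      omega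
  · intro r hr s hs hrs
    simp only [Finset.coe_Ioo, Set.mem_Ioo] at hr hs
    have h1 := key r hr.2
    simp only at hrs
    rw [hrs, key s hs.2] at h1
    have := congrArg ZMod.val h1
    rwa [ZMod.val_cast_of_lt hr.2, ZMod.val_cast_of_lt hs.2, eq_comm] at this

/-! ### Residue characters and Jacobi sums in the residue field -/

theorem FiniteField.sum_eval_eq_zero {F : Type*} [Field F] [Fintype F] (f : Polynomial F)
    (hf : f.natDegree < Fintype.card F - 1) : ∑ x : F, f.eval x = 0 := by
  simp_rw [Polynomial.eval_eq_sum_range]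
  rw [Finset.sum_comm]
  refine Finset.sum_eq_zero fun i hi => ?_
  rw [← Finset.mul_sum, FiniteField.sum_pow_lt_card_sub_one, mul_zero]
  rw [Finset.mem_range] at hi
  omega

theorem FiniteField.sum_pow_mul_one_sub_pow {F : Type*} [Field F] [Fintype F] {a b : ℕ}
    (hab : a + b < Fintype.card F - 1) : ∑ x : F, x ^ a * (1 - x) ^ b = 0 := by
  have h := FiniteField.sum_eval_eq_zero
    ((Polynomial.X : Polynomial F) ^ a * (1 - Polynomial.X) ^ b) (lt_of_le_of_lt ?_ hab)
  · simpa using h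
  · compute_degree

/-- The inverse of the `k`-th power residue character attached to a reduction map. -/
theorem exists_mulChar_eq_pow {R F : Type*} [CommRing R] [IsDomain R] [Field F] [Fintype F]
    {p k : ℕ} (hp : p.Prime) (hk : Fintype.card F - 1 = p * k) (ρ : R →+* F) {z : R}
    (hz : IsPrimitiveRoot z p) (hρz : ρ z ≠ 1) :
    ∃ χ : MulChar F R, orderOf χ = p ∧ ∀ x : F, ρ (χ x) = x ^ ((p - 1) * k) := by
  classical
  have : NeZero p := ⟨hp.ne_zero⟩
  have : Fact p.Prime := ⟨hp⟩
  have hcard : Fintype.card Fˣ = p * k := by rw [Fintype.card_units, hk]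
  have hk0 : 0 < k := by
    rcases Nat.eq_zero_or_pos k with h | h
    · have := Fintype.card_pos (α := Fˣ)
      simp [h] at hcard
    · exact h
  obtain ⟨g, hg⟩ := IsCyclic.exists_generator (α := Fˣ)
  have hog : orderOf g = p * k := by
    rw [orderOf_eq_card_of_forall_mem_zpowers hg, Nat.card_eq_fintype_card, hcard]
  have hρp : IsPrimitiveRoot (ρ z) p := by
    have : orderOf (ρ z) = p := orderOf_eq_prime (by rw [← map_pow, hz.pow_eq_one, map_one]) hρz
    exact this ▸ IsPrimitiveRoot.orderOf (ρ z)
  have hgp : ((g : F) ^ ((p - 1) * k)) ^ p = 1 := by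
    rw [← pow_mul, mul_assoc, mul_comm k p, mul_comm, pow_mul, ← hog]
    rw [← Units.val_pow_eq_pow_val, pow_orderOf_eq_one, Units.val_one, one_pow]
  obtain ⟨r, hr, hr'⟩ := hρp.eq_pow_of_pow_eq_one hgp
  obtain ⟨u, hu⟩ := (hz.isUnit hp.ne_zero).pow r
  have hup : u ^ p = 1 := by
    ext
    rw [Units.val_pow_eq_pow_val, hu, ← pow_mul, mul_comm, pow_mul, hz.pow_eq_one, one_pow,
      Units.val_one]
  have hmem : u ∈ rootsOfUnity (Fintype.card Fˣ) R := by
    rw [mem_rootsOfUnity, hcard, pow_mul, hup, one_pow]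
  let χ : MulChar F R := MulChar.ofRootOfUnity hmem hg
  have hχg : χ g = u := MulChar.ofRootOfUnity_spec hmem hg
  have hval (x : F) : ρ (χ x) = x ^ ((p - 1) * k) := by
    by_cases hx : x = 0
    · have := hp.two_le
      rw [hx, χ.map_zero, map_zero, zero_pow]
      exact Nat.mul_ne_zero (by omega) (by omega)
    · obtain ⟨n, hn⟩ := (mem_powers_iff_mem_zpowers.mpr (hg (Units.mk0 x hx)))
      have hxn : x = (g : F) ^ n := by
        rw [← Units.val_pow_eq_pow_val]
        simpa using (congrArg Units.val hn).symm
      rw [hxn, map_pow, map_pow, hχg, hu, map_pow, hr', ← pow_mul, ← pow_mul, mul_comm]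
  refine ⟨χ, orderOf_eq_prime ?_ ?_, hval⟩
  · rw [MulChar.eq_iff hg, MulChar.pow_apply' _ hp.ne_zero, hχg, MulChar.one_apply_coe,
      ← Units.val_pow_eq_pow_val, hup, Units.val_one]
  · intro h1
    have h2 := hval g
    rw [h1, MulChar.one_apply_coe, map_one, ← Units.val_pow_eq_pow_val, eq_comm, Units.val_eq_one,
      ← orderOf_dvd_iff_pow_eq_one, hog] at h2
    have h3 := Nat.dvd_of_mul_dvd_mul_right hk0 h2
    have := hp.two_le
    have := Nat.le_of_dvd (by omega) h3
    omega

/-- Through `ρ`, `χ ^ a` becomes `x ↦ x ^ ((p - a) * k)`, so the Jacobi sum becomes the sum over `F`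
of a polynomial of degree at most `(2p - a - b) * k`. The condition `p < a + b` puts this below `p *
k = |F| - 1`. -/
theorem map_jacobiSum_pow_eq_zero {R F : Type*} [CommRing R] [Field F] [Fintype F]
    {p k : ℕ} (hk : Fintype.card F - 1 = p * k) (ρ : R →+* F) {χ : MulChar F R}
    (hρχ : ∀ x : F, ρ (χ x) = x ^ ((p - 1) * k)) {a b : ℕ} (ha : 1 ≤ a) (hap : a < p)
    (hb : 1 ≤ b) (hbp : b < p) (hab : p < a + b) : ρ (jacobiSum (χ ^ a) (χ ^ b)) = 0 := by
  have hk0 : 0 < k := by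
    rcases Nat.eq_zero_or_pos k with h | h
    · have := Fintype.one_lt_card (α := F)
      rw [h, mul_zero] at hk
      omega
    · exact h
  have hval {a : ℕ} (ha : 1 ≤ a) (hap : a < p) (x : F) : ρ ((χ ^ a) x) = x ^ ((p - a) * k) := by
    rw [MulChar.pow_apply' _ (by omega), map_pow, hρχ, ← pow_mul]
    by_cases hx : x = 0
    · rw [hx, zero_pow, zero_pow]
      · exact Nat.mul_ne_zero (by omega) (by omega)
      · exact Nat.mul_ne_zero (Nat.mul_ne_zero (by omega) (by omega)) (by omega)
    · have h1 : x ^ (p * k) = 1 := by rw [← hk]; exact FiniteField.pow_card_sub_one_eq_one x hx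
      have h2 : (p - 1) * k * a = p * k * (a - 1) + (p - a) * k := by
        zify [ha, hap.le, (by omega : 1 ≤ p)]
        ring
      rw [h2, pow_add, pow_mul, h1, one_pow, one_mul]
  rw [jacobiSum, map_sum]
  simp_rw [map_mul, hval ha hap, hval hb hbp]
  apply FiniteField.sum_pow_mul_one_sub_pow
  rw [hk, ← add_mul]
  exact Nat.mul_lt_mul_of_pos_right (by omega) hk0

/-! ### Stickelberger divisibility and absolute value of `G` -/

/-- The `p`-th power of the Gauss sum of a character of order `p`, written through Jacobi sums. -/
noncomputable def jacobiProd {R F : Type*} [CommRing R] [Field F] [Fintype F] (p : ℕ)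
    (χ : MulChar F R) : R :=
  Fintype.card F * ∏ j ∈ Finset.Ico 1 (p - 1), jacobiSum χ (χ ^ j)

theorem Ideal.prod_mem_pow_card_filter {R ι : Type*} [CommRing R] (I : Ideal R) (s : Finset ι)
    (f : ι → R) (P : ι → Prop) [DecidablePred P] (h : ∀ i ∈ s, P i → f i ∈ I) :
    ∏ i ∈ s, f i ∈ I ^ (s.filter P).card := by
  rw [← Finset.prod_filter_mul_prod_filter_not s P]
  refine Ideal.mul_mem_right _ _ ?_
  rw [← Finset.prod_const]
  refine Ideal.prod_mem_prod fun i hi => ?_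
  rw [Finset.mem_filter] at hi
  exact h i hi.1 hi.2

theorem MulChar.ringHomComp_eq_pow {R F : Type*} [CommRing R] [IsDomain R] [Field F] [Fintype F]
    {p : ℕ} [NeZero p] {χ : MulChar F R} (hχ : χ ^ p = 1) {z : R} (hz : IsPrimitiveRoot z p)
    {f : R →+* R} {n : ℕ} (hf : f z = z ^ n) : χ.ringHomComp f = χ ^ n := by
  ext a
  obtain ⟨k, -, hk⟩ := MulChar.exists_apply_eq_pow hχ hz a.ne_zero
  rw [MulChar.ringHomComp_apply, MulChar.pow_apply_coe, hk, map_pow, hf, ← pow_mul, ← pow_mul,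
    mul_comm]

/-- The map `f` turns `χ` into `χ ^ t`. The factor `|F|` contributes one power of the kernel, and
the Jacobi sums that vanish under `ρ` contribute at least `t - 1` more. -/
theorem map_jacobiProd_mem_ker_pow {R F : Type*} [CommRing R] [IsDomain R] [Field F] [Fintype F]
    {p k : ℕ} [Fact p.Prime] (hk : Fintype.card F - 1 = p * k) (ρ : R →+* F) {χ : MulChar F R}
    (hχ : χ ^ p = 1) (hρχ : ∀ x : F, ρ (χ x) = x ^ ((p - 1) * k)) {z : R}
    (hz : IsPrimitiveRoot z p) {f : R →+* R} {t : ZMod p} (ht : t ≠ 0) (hf : f z = z ^ t.val) :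
    f (jacobiProd p χ) ∈ RingHom.ker ρ ^ t.val := by
  classical
  have hp : p.Prime := Fact.out
  have : NeZero p := ⟨hp.ne_zero⟩
  have ht1 : 1 ≤ t.val := Nat.one_le_iff_ne_zero.mpr (by rwa [Ne, ZMod.val_eq_zero])
  have hexp (j : ℕ) : (χ ^ j) ^ t.val = χ ^ (t * j).val := by
    rw [← pow_mul, pow_eq_pow_iff_modEq]
    refine Nat.ModEq.of_dvd (orderOf_dvd_of_pow_eq_one hχ) ?_
    rw [← ZMod.natCast_eq_natCast_iff, ZMod.natCast_zmod_val]
    push_cast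
    rw [ZMod.natCast_zmod_val, mul_comm]
  have hfG : f (jacobiProd p χ) = Fintype.card F *
      ∏ j ∈ Finset.Ico 1 (p - 1), jacobiSum (χ ^ t.val) (χ ^ (t * j).val) := by
    rw [jacobiProd, map_mul, map_natCast, map_prod]
    congr 1
    refine Finset.prod_congr rfl fun j _ => ?_
    rw [← jacobiSum_ringHomComp, ← MulChar.ringHomComp_pow, MulChar.ringHomComp_eq_pow hχ hz hf,
      ← hexp, ← pow_mul, ← pow_mul, mul_comm]
  rw [hfG]
  have h1 : (Fintype.card F : R) ∈ RingHom.ker ρ := by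
    rw [RingHom.mem_ker, map_natCast, FiniteField.cast_card_eq_zero]
  have h2 := Ideal.prod_mem_pow_card_filter (RingHom.ker ρ) (Finset.Ico 1 (p - 1))
    (fun j : ℕ => jacobiSum (χ ^ t.val) (χ ^ (t * j).val))
    (fun j : ℕ => p < t.val + (t * j).val) (fun j hj hlt => by
      have := (t * j).val_lt
      have := t.val_lt
      exact map_jacobiSum_pow_eq_zero hk ρ hρχ ht1 t.val_lt (by omega) (t * j).val_lt hlt)
  have h3 := Ideal.mul_mem_mul h1 h2
  rw [← pow_succ'] at h3
  refine Ideal.pow_le_pow_right ?_ h3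
  have := le_card_filter_lt_val_add_val ht
  omega

/-- Since `χ`, `χ ^ j` and `χ ^ (j + 1)` are nontrivial, each of the `p - 2` Jacobi sums has product
`|F|` with its conjugate; the factor `|F|` of `G` supplies the other two. -/
theorem jacobiProd_mul_map {K R F : Type*} [Field K] [CharZero K] [CommRing R] [IsDomain R]
    [Algebra R K] [FaithfulSMul R K] [Field F] [Fintype F] {p : ℕ} [Fact p.Prime]
    {χ : MulChar F R} (hχ : orderOf χ = p) {z : R} (hz : IsPrimitiveRoot z p)
    {f : R →+* R} (hf : f z = z ^ (p - 1)) :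
    jacobiProd p χ * f (jacobiProd p χ) = (Fintype.card F : R) ^ p := by
  have hp : p.Prime := Fact.out
  have hp2 := hp.two_le
  have : NeZero p := ⟨hp.ne_zero⟩
  have hinj : Function.Injective (algebraMap R K) := FaithfulSMul.algebraMap_injective R K
  have hχp : χ ^ p = 1 := hχ ▸ pow_orderOf_eq_one χ
  have hinv : χ ^ (p - 1) = χ⁻¹ := by
    rw [eq_inv_iff_mul_eq_one, ← pow_succ, Nat.sub_add_cancel hp.one_le, hχp]
  have hne (n : ℕ) (h1 : 1 ≤ n) (h2 : n < p) : χ ^ n ≠ 1 := fun h => by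
    have := Nat.le_of_dvd (by omega) (hχ ▸ orderOf_dvd_of_pow_eq_one h)
    omega
  have hJ (j : ℕ) (hj : j ∈ Finset.Ico 1 (p - 1)) :
      jacobiSum χ (χ ^ j) * f (jacobiSum χ (χ ^ j)) = Fintype.card F := by
    rw [Finset.mem_Ico] at hj
    rw [← jacobiSum_ringHomComp, ← MulChar.ringHomComp_pow, MulChar.ringHomComp_eq_pow hχp hz hf,
      hinv]
    apply hinj
    rw [map_mul, ← jacobiSum_ringHomComp, ← jacobiSum_ringHomComp, map_natCast, inv_pow,
      ← MulChar.ringHomComp_inv, ← MulChar.ringHomComp_inv]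
    refine jacobiSum_mul_jacobiSum_inv ?_ ?_ ?_ ?_
    · rw [ringChar.eq_zero]
      exact (CharP.char_is_prime F (ringChar F)).ne_zero.symm
    · rw [MulChar.ringHomComp_ne_one_iff hinj]
      simpa using hne 1 le_rfl (by omega)
    · rw [MulChar.ringHomComp_ne_one_iff hinj]
      exact hne j hj.1 (by omega)
    · rw [← MulChar.ringHomComp_mul, MulChar.ringHomComp_ne_one_iff hinj, ← pow_succ']
      exact hne _ (by omega) (by omega)
  rw [jacobiProd, map_mul, map_natCast, map_prod, mul_mul_mul_comm, ← Finset.prod_mul_distrib,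
    Finset.prod_congr rfl hJ, Finset.prod_const, Nat.card_Ico, ← pow_two, ← pow_add]
  congr 1
  omega

/-! ### The Gauss sum modulo `π` -/

/-- Nonzero values of `χ` are powers of `z`, hence `1` modulo `z - 1`. The Gauss sum is therefore
congruent to the sum of `ψ` over nonzero elements, which is `-1`. Its `p`-th power is `G`. -/
theorem sub_one_pow_dvd_jacobiProd_add_one {K : Type*} [Field K] [NumberField K] {F : Type*}
    [Field F] [Fintype F] {p : ℕ} [Fact p.Prime] (hodd : Odd p) {χ : MulChar F (𝓞 K)}
    (hχ : orderOf χ = p) {z : 𝓞 K} (hz : IsPrimitiveRoot z p) :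
    (z - 1) ^ p ∣ jacobiProd p χ + 1 := by
  classical
  have hp : p.Prime := Fact.out
  have hp2 := hp.two_le
  have : NeZero p := ⟨hp.ne_zero⟩
  have hχp : χ ^ p = 1 := hχ ▸ pow_orderOf_eq_one χ
  have hchar : ringChar K ≠ ringChar F := by
    rw [ringChar.eq_zero]
    exact (CharP.char_is_prime F (ringChar F)).ne_zero.symm
  obtain ⟨n, ψ, hψ⟩ := AddChar.FiniteField.primitiveChar F K hchar
  let L := CyclotomicField n K
  let S := integralClosure ℤ L
  have hmap (a : 𝓞 K) : IsIntegral ℤ (algebraMap K L a) := a.isIntegral_coe.map (IsScalarTower.toAlgHom ℤ K L)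
  let ι : 𝓞 K →+* S :=
    ((algebraMap K L).comp (algebraMap (𝓞 K) K)).codRestrict S hmap
  have hψint (a : F) : IsIntegral ℤ (ψ a) := by
    refine IsIntegral.of_pow (n := ringChar F) (CharP.char_is_prime F (ringChar F)).pos ?_
    rw [← AddChar.map_nsmul_eq_pow, nsmul_eq_mul, ringChar.Nat.cast_ringChar, zero_mul,
      AddChar.map_zero_eq_one]
    exact isIntegral_one
  have hψ1 : ψ ≠ 1 := fun h => by
    have := hψ one_ne_zero
    simp [h] at this
  have hsum := AddChar.sum_eq_zero_of_ne_one hψ1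
  let χ' : MulChar F L := χ.ringHomComp ((algebraMap K L).comp (algebraMap (𝓞 K) K))
  have hcompinj : Function.Injective ((algebraMap K L).comp (algebraMap (𝓞 K) K)) :=
    (algebraMap K L).injective.comp RingOfIntegers.coe_injective
  have hχ' : orderOf χ' = p := by
    refine orderOf_eq_prime ?_ ?_
    · rw [MulChar.ringHomComp_pow, hχp, MulChar.ringHomComp_one]
    · refine (MulChar.ringHomComp_ne_one_iff hcompinj).mpr ?_
      rintro rfl
      rw [orderOf_one] at hχ
      omega
  have hg := gaussSum_pow_eq_prod_jacobiSum (χ := χ') (ψ := ψ) (by omega) hψ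
  -- The value has order dividing both `2` and the odd number `p`; this removes the sign in the
  -- Jacobi sum formula.
  have hneg : χ' (-1) = 1 := by
    have h1 : χ' (-1) ^ p = 1 := by
      rw [← MulChar.pow_apply' _ hp.ne_zero, ← hχ', pow_orderOf_eq_one]
      exact MulChar.one_apply isUnit_one.neg
    have h2 : χ' (-1) ^ 2 = 1 := by
      rw [← map_pow, neg_one_sq, map_one]
    have h3 : Nat.gcd p 2 = 1 := hodd.coprime_two_right
    have := pow_gcd_eq_one.mpr ⟨h1, h2⟩
    rwa [h3, pow_one] at this
  have hgG : gaussSum χ' ψ ^ p = algebraMap K L (algebraMap (𝓞 K) K (jacobiProd p χ)) := by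
    rw [hχ', hneg, one_mul] at hg
    rw [hg, jacobiProd]
    simp only [map_mul, map_natCast, map_prod]
    congr 1
    refine Finset.prod_congr rfl fun j _ => ?_
    rw [MulChar.ringHomComp_pow, jacobiSum_ringHomComp]
    rfl
  -- The correction at `a = 0` makes up for `χ' 0 = 0` against `ψ 0 = 1`; summed over `a`, it gives
  -- the `+ 1`.
  have hterm (a : F) : ∃ y : S, χ' a * ψ a + (if a = 0 then 1 else 0) - ψ a = ι (z - 1) * y := by
    by_cases ha : a = 0
    · refine ⟨0, ?_⟩
      simp [ha, χ'.map_zero]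
    · obtain ⟨k, -, hk⟩ := MulChar.exists_apply_eq_pow hχp hz ha
      obtain ⟨y, hy⟩ := (one_sub_dvd_one_sub_pow z k)
      refine ⟨ι y * ⟨ψ a, hψint a⟩, ?_⟩
      have h1 : χ' a = (ι (z ^ k) : S) := by rw [← hk]; rfl
      have h2 : z ^ k = (z - 1) * y + 1 := by linear_combination -hy
      rw [h1, h2, if_neg ha, map_add, map_mul, map_one]
      push_cast
      ring
  choose y hy using hterm
  have hgS : gaussSum χ' ψ = (ι (z - 1) * ∑ a, y a - 1 : S) := by
    have h1 : ∑ a, (χ' a * ψ a + (if a = 0 then 1 else 0) - ψ a) =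
        ∑ a, (ι (z - 1) * y a : L) := Finset.sum_congr rfl fun a _ => hy a
    rw [Finset.sum_sub_distrib, Finset.sum_add_distrib, hsum, Finset.sum_ite_eq' Finset.univ,
      if_pos (Finset.mem_univ _), sub_zero, ← Finset.mul_sum] at h1
    push_cast
    rw [← h1, gaussSum]
    ring
  have hdvd : ι (z - 1) ^ (1 + (p - 1)) ∣ (ι (z - 1) * ∑ a, y a - 1) ^ p + 1 := by
    refine dvd_pow_prime_add_one hp hodd le_rfl ?_ ?_
    · obtain ⟨c, -, hc⟩ := hz.self_sub_one_pow_dvd_order (k := p - 1) (by omega)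
      refine ⟨ι c, ?_⟩
      rw [← map_natCast ι, hc, map_mul, map_pow, mul_comm]
    · exact ⟨∑ a, y a, by ring⟩
  obtain ⟨w, hw⟩ := hdvd
  have hwL : algebraMap K L (algebraMap (𝓞 K) K (jacobiProd p χ + 1)) =
      algebraMap K L (algebraMap (𝓞 K) K ((z - 1) ^ p)) * w := by
    have h1 := congrArg (Subtype.val : S → L) hw
    rw [Nat.add_sub_cancel' hp.one_le] at h1
    rw [map_add, map_add, ← hgG, hgS, map_one, map_one, map_pow, map_pow]
    exact h1
  have hz1 : algebraMap (𝓞 K) K ((z - 1) ^ p) ≠ 0 := by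
    rw [map_ne_zero_iff _ RingOfIntegers.coe_injective]
    exact pow_ne_zero _ (sub_ne_zero.mpr (hz.ne_one hp.one_lt))
  -- Divisibility descends from `S`: the quotient lies in `K` and is integral over `ℤ`.
  have hwK : algebraMap K L (algebraMap (𝓞 K) K (jacobiProd p χ + 1) /
      algebraMap (𝓞 K) K ((z - 1) ^ p)) = w := by
    rw [map_div₀, hwL, mul_div_cancel_left₀]
    rwa [map_ne_zero_iff _ (algebraMap K L).injective]
  have hint : IsIntegral ℤ (algebraMap (𝓞 K) K (jacobiProd p χ + 1) /
      algebraMap (𝓞 K) K ((z - 1) ^ p)) := by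
    rw [← isIntegral_algebraMap_iff (algebraMap K L).injective, hwK]
    exact w.2
  obtain ⟨c, hc⟩ : ∃ c : 𝓞 K, algebraMap (𝓞 K) K c =
      algebraMap (𝓞 K) K (jacobiProd p χ + 1) / algebraMap (𝓞 K) K ((z - 1) ^ p) :=
    ⟨⟨_, hint⟩, rfl⟩
  refine ⟨c, RingOfIntegers.coe_injective ?_⟩
  rw [map_mul, hc]
  exact (mul_div_cancel₀ _ hz1).symm

theorem root_pow_eq_pow_iff {p : ℕ} [Fact p.Prime] {K : Type*} [Field K] {ζ : K}
    (hζ : IsPrimitiveRoot ζ p) {a b : ℕ} :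
    ζ ^ a = ζ ^ b ↔ (a : ZMod p) = b := by
  have hp : p.Prime := Fact.out
  have hmod (n : ℕ) : ζ ^ (n % p) = ζ ^ n := by
    conv_lhs => rw [hζ.eq_orderOf]
    exact pow_mod_orderOf ζ n
  rw [ZMod.natCast_eq_natCast_iff, ← hmod a, ← hmod b]
  exact ⟨fun h => hζ.pow_inj (Nat.mod_lt _ hp.pos) (Nat.mod_lt _ hp.pos) h,
    fun h => congrArg (ζ ^ ·) h⟩

/-! ### The Galois action and the exponent `P(σ)` -/

section

variable {p : ℕ} [Fact p.Prime] {K : Type*} [Field K] [NumberField K] {ζ : K}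

theorem pow_apply_root {v : ℕ} {σ : Gal(K/ℚ)} (hσ : σ ζ = ζ ^ v) (i : ℕ) :
    (σ ^ i) ζ = ζ ^ v ^ i := by
  induction i with
  | zero => simp
  | succ n ih => rw [pow_succ', AlgEquiv.mul_apply, ih, map_pow, hσ, ← pow_mul, pow_succ']

theorem powP_mul (v : ℕ) (σ : Gal(K/ℚ)) (A B : 𝓞 K) :
    powP p v σ (A * B) = powP p v σ A * powP p v σ B := by
  simp only [powP, smul_mul', mul_pow, Finset.prod_mul_distrib]

theorem powP_pow (v : ℕ) (σ : Gal(K/ℚ)) (A : 𝓞 K) (n : ℕ) :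
    powP p v σ (A ^ n) = powP p v σ A ^ n := by
  simp only [powP, smul_pow', ← Finset.prod_pow]
  refine Finset.prod_congr rfl fun i _ => by rw [← pow_mul, ← pow_mul, mul_comm]

theorem pow_smul_powP (v : ℕ) (σ : Gal(K/ℚ)) (A : 𝓞 K) (n : ℕ) :
    (σ ^ n) • powP p v σ A = powP p v σ ((σ ^ n) • A) := by
  simp only [powP, Finset.smul_prod', smul_pow', smul_smul, ← pow_add, add_comm]

/-- The exponents attached to `σ ^ i` and to its complex conjugate add up to `p`. -/
theorem powP_of_conj_fixed (hp : Odd p) {v : ℕ} (hv : IsPrimitiveRoot (v : ZMod p) (p - 1))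
    {σ : Gal(K/ℚ)} {D : 𝓞 K} (hD : (σ ^ ((p - 1) / 2)) • D = D) :
    powP p v σ D ^ 2 = (∏ i ∈ Finset.range (p - 1), (σ ^ i) • D) ^ p := by
  have hp' : p.Prime := Fact.out
  set h := (p - 1) / 2 with hh
  have hhalf : p - 1 = h * 2 := by obtain ⟨c, rfl⟩ := hp; omega
  have hv1 : (v : ZMod p) ^ h = -1 :=
    (hv.pow (by have := hp'.two_le; omega) hhalf).eq_neg_one_of_two_right
  have hv0 : (v : ZMod p) ≠ 0 := hv.ne_zero (by have := hp'.two_le; omega)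
  have hshift (i : ℕ) : (σ ^ (h + i)) • D = (σ ^ i) • D := by
    rw [add_comm, pow_add, mul_smul, hD]
  have hexp (i : ℕ) : ((v : ZMod p) ^ (-(i : ℤ))).val +
      ((v : ZMod p) ^ (-((h + i : ℕ) : ℤ))).val = p := by
    have h1 : (v : ZMod p) ^ (-((h + i : ℕ) : ℤ)) = -((v : ZMod p) ^ (-(i : ℤ))) := by
      rw [zpow_neg, zpow_natCast, pow_add, hv1, zpow_neg, zpow_natCast, neg_one_mul, inv_neg]
    have : NeZero ((v : ZMod p) ^ (-(i : ℤ))) := ⟨zpow_ne_zero _ hv0⟩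
    rw [h1, ZMod.val_neg_of_ne_zero]
    have := ((v : ZMod p) ^ (-(i : ℤ))).val_lt
    omega
  have h1 : powP p v σ D = (∏ i ∈ Finset.range h, (σ ^ i) • D) ^ p := by
    rw [powP, hhalf, mul_two, Finset.prod_range_add, ← Finset.prod_mul_distrib, ← Finset.prod_pow]
    refine Finset.prod_congr rfl fun i _ => ?_
    rw [hshift, ← pow_add, hexp]
  have h2 : ∏ i ∈ Finset.range (p - 1), (σ ^ i) • D = (∏ i ∈ Finset.range h, (σ ^ i) • D) ^ 2 := by
    rw [hhalf, mul_two, Finset.prod_range_add, pow_two]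
    simp_rw [hshift]
  rw [h1, h2, ← pow_mul, ← pow_mul, mul_comm]

variable [IsCyclotomicExtension {p} ℚ K]

theorem galEquiv_ext_of_apply_root (hζ : IsPrimitiveRoot ζ p) {σ τ : Gal(K/ℚ)} (h : σ ζ = τ ζ) :
    σ = τ := by
  have : NeZero p := ⟨(Fact.out : p.Prime).ne_zero⟩
  have := (hζ.powerBasis ℚ).algHom_ext (f := (σ : K →ₐ[ℚ] K)) (g := (τ : K →ₐ[ℚ] K))
    (by simpa using h)
  ext x
  exact DFunLike.congr_fun this x

theorem embedding_apply_conj (hζ : IsPrimitiveRoot ζ p) {conj : Gal(K/ℚ)} (hconj : conj ζ = ζ⁻¹)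
    (φ : K →+* ℂ) (x : K) : φ (conj x) = star (φ x) := by
  have : NeZero p := ⟨(Fact.out : p.Prime).ne_zero⟩
  have h := (hζ.powerBasis ℚ).algHom_ext
    (f := ((φ.comp (conj : K →+* K)).toRatAlgHom))
    (g := (((starRingEnd ℂ).comp φ).toRatAlgHom)) (by
      simp only [IsPrimitiveRoot.powerBasis_gen]
      change φ (conj ζ) = star (φ ζ)
      rw [hconj, map_inv₀, Complex.inv_eq_conj]
      · rfl
      · refine Complex.norm_eq_one_of_pow_eq_one (n := p) ?_ (NeZero.ne p)
        rw [← map_pow, hζ.pow_eq_one, map_one])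
  exact DFunLike.congr_fun h x

theorem conj_smul_algebraMap (hζ : IsPrimitiveRoot ζ p) {conj : Gal(K/ℚ)} (hconj : conj ζ = ζ⁻¹)
    (D : 𝓞 (maximalRealSubfield K)) :
    conj • algebraMap (𝓞 (maximalRealSubfield K)) (𝓞 K) D =
      algebraMap (𝓞 (maximalRealSubfield K)) (𝓞 K) D := by
  apply RingOfIntegers.coe_injective
  obtain ⟨φ⟩ : Nonempty (K →+* ℂ) := inferInstance
  apply φ.injective
  change φ (conj (D : maximalRealSubfield K)) = φ (D : maximalRealSubfield K)
  rw [embedding_apply_conj hζ hconj]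
  exact (mem_maximalRealSubfield_iff _).mp (D : maximalRealSubfield K).2 φ

theorem pow_half_eq_conj (hp : Odd p) (hζ : IsPrimitiveRoot ζ p) {v : ℕ}
    (hv : IsPrimitiveRoot (v : ZMod p) (p - 1)) {σ : Gal(K/ℚ)} (hσ : σ ζ = ζ ^ v)
    {conj : Gal(K/ℚ)} (hconj : conj ζ = ζ⁻¹) : σ ^ ((p - 1) / 2) = conj := by
  have hp' : p.Prime := Fact.out
  have hhalf : p - 1 = (p - 1) / 2 * 2 := by obtain ⟨c, rfl⟩ := hp; omega
  apply galEquiv_ext_of_apply_root hζ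
  have h1 : (v : ZMod p) ^ ((p - 1) / 2) = -1 :=
    (hv.pow (by have := hp'.two_le; omega) hhalf).eq_neg_one_of_two_right
  rw [pow_apply_root hσ, hconj]
  apply eq_inv_of_mul_eq_one_left
  rw [← pow_succ, ← pow_zero ζ, root_pow_eq_pow_iff hζ]
  push_cast
  rw [h1, neg_add_cancel]

theorem prod_range_pow_smul (hζ : IsPrimitiveRoot ζ p) {v : ℕ}
    (hv : IsPrimitiveRoot (v : ZMod p) (p - 1)) {σ : Gal(K/ℚ)} (hσ : σ ζ = ζ ^ v) (A : 𝓞 K) :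
    ∏ i ∈ Finset.range (p - 1), (σ ^ i) • A = algebraMap ℤ (𝓞 K) (Algebra.norm ℤ A) := by
  classical
  have hp : p.Prime := Fact.out
  have : NeZero p := ⟨hp.ne_zero⟩
  have : IsGalois ℚ K := IsCyclotomicExtension.isGalois {p} ℚ K
  have hinj : Set.InjOn (fun i : ℕ => σ ^ i) (Finset.range (p - 1)) := fun i hi j hj hij => by
    have h1 := congrArg (fun τ : Gal(K/ℚ) => τ ζ) hij
    simp only [pow_apply_root hσ] at h1
    rw [root_pow_eq_pow_iff hζ] at h1
    push_cast at h1
    exact hv.pow_inj (by simpa using hi) (by simpa using hj) h1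
  have himg : (Finset.range (p - 1)).image (fun i : ℕ => σ ^ i) = Finset.univ := by
    rw [← Finset.card_eq_iff_eq_univ, Finset.card_image_of_injOn hinj, Finset.card_range,
      ← Nat.card_eq_fintype_card, IsGalois.card_aut_eq_finrank,
      IsCyclotomicExtension.Rat.finrank p K, Nat.totient_prime hp]
  apply RingOfIntegers.coe_injective
  rw [map_prod, ← IsScalarTower.algebraMap_apply ℤ (𝓞 K) K, IsScalarTower.algebraMap_apply ℤ ℚ K,
    algebraMap_int_eq, eq_intCast, Algebra.coe_norm_int, Algebra.norm_eq_prod_automorphisms, ← himg, Finset.prod_image hinj]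
  rfl

/-- Apply `P(σ)` to `A * conj A = D ^ p`. As `D` is fixed by conjugation, the square of `D ^ P(σ)`
is the `p`-th power of the product of the conjugates of `D`, and `D ^ p` turns this back into norms
of `A` and `conj A`. Squaring is needed because exponents pair up over half of the Galois group. -/
theorem powP_mul_conj_sq (hp : Odd p) (hζ : IsPrimitiveRoot ζ p) {v : ℕ}
    (hv : IsPrimitiveRoot (v : ZMod p) (p - 1)) {σ : Gal(K/ℚ)} (hσ : σ ζ = ζ ^ v)
    {conj : Gal(K/ℚ)} (hconj : conj ζ = ζ⁻¹) {A : 𝓞 K} {D : 𝓞 (maximalRealSubfield K)}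
    (hD : A * conj • A = algebraMap (𝓞 (maximalRealSubfield K)) (𝓞 K) D ^ p) :
    (powP p v σ A * conj • powP p v σ A) ^ 2 =
      (algebraMap ℤ (𝓞 K) (Algebra.norm ℤ A) ^ 2) ^ p := by
  have hhalf := pow_half_eq_conj hp hζ hv hσ hconj
  have hfix := conj_smul_algebraMap hζ hconj D
  have hN := prod_range_pow_smul hζ hv hσ
  have hconjN : algebraMap ℤ (𝓞 K) (Algebra.norm ℤ (conj • A)) =
      algebraMap ℤ (𝓞 K) (Algebra.norm ℤ A) := by
    rw [← hN, ← hN]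
    have h1 : ∏ i ∈ Finset.range (p - 1), (σ ^ i) • conj • A =
        conj • ∏ i ∈ Finset.range (p - 1), (σ ^ i) • A := by
      simp only [Finset.smul_prod', smul_smul, ← hhalf, ← pow_add, add_comm]
    rw [h1, hN]
    exact map_intCast (MulSemiringAction.toRingHom Gal(K/ℚ) (𝓞 K) conj) _
  rw [← hhalf, pow_smul_powP, ← powP_mul, hhalf, hD, powP_pow, ← pow_mul, mul_comm, pow_mul,
    powP_of_conj_fixed hp hv (by rw [hhalf, hfix]), ← Finset.prod_pow]
  simp_rw [← smul_pow', ← hD, smul_mul', Finset.prod_mul_distrib]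
  rw [hN, hN, hconjN, pow_two]

end

/-! ### Conjugate primes and roots of unity -/

section

variable {p : ℕ} [Fact p.Prime] {K : Type*} [Field K] [NumberField K]
  [IsCyclotomicExtension {p} ℚ K] {ζ : K}

theorem exists_ringHom_zmod_ker_eq {q : Ideal (𝓞 K)} {l : ℕ} (hl : l.Prime)
    (hq : Ideal.absNorm q = l) : ∃ ρ : 𝓞 K →+* ZMod l, RingHom.ker ρ = q := by
  have hcard : Nat.card (𝓞 K ⧸ q) = l := by
    rw [← hq, Ideal.absNorm_apply, Submodule.cardQuot_apply]
  have : Finite (𝓞 K ⧸ q) := Nat.finite_of_card_ne_zero (by rw [hcard]; exact hl.ne_zero)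
  have := Fintype.ofFinite (𝓞 K ⧸ q)
  let e := ZMod.ringEquivOfPrime (𝓞 K ⧸ q) hl (by rw [← Nat.card_eq_fintype_card, hcard])
  refine ⟨(e.symm : 𝓞 K ⧸ q →+* ZMod l).comp (Ideal.Quotient.mk q), ?_⟩
  ext x
  simp [RingHom.mem_ker, Ideal.Quotient.eq_zero_iff_mem]

/-- Distinct conjugates of a degree one prime away from `p` are coprime. -/
theorem isCoprime_map_gal_pow (hζ : IsPrimitiveRoot ζ p) {v : ℕ}
    (hv : IsPrimitiveRoot (v : ZMod p) (p - 1)) {σ : Gal(K/ℚ)} (hσ : σ ζ = ζ ^ v)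
    {l : ℕ} (hl : l.Prime) (hlp : l ≠ p) (ρ : 𝓞 K →+* ZMod l) {i j : ℕ} (hi : i < p - 1)
    (hj : j < p - 1) (hij : i ≠ j) :
    IsCoprime ((RingHom.ker ρ).map (MulSemiringAction.toRingHom Gal(K/ℚ) (𝓞 K) (σ ^ i)))
      ((RingHom.ker ρ).map (MulSemiringAction.toRingHom Gal(K/ℚ) (𝓞 K) (σ ^ j))) := by
  have hp : p.Prime := Fact.out
  have : NeZero p := ⟨hp.ne_zero⟩
  have : NeZero l := ⟨hl.ne_zero⟩
  have hz := hζ.toInteger_isPrimitiveRoot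
  set z := hζ.toInteger with hz'
  set I := fun i : ℕ =>
    (RingHom.ker ρ).map (MulSemiringAction.toRingHom Gal(K/ℚ) (𝓞 K) (σ ^ i)) with hI
  have hσz (i : ℕ) : (σ ^ i) • z = z ^ v ^ i :=
    RingOfIntegers.coe_injective (pow_apply_root hσ i)
  -- The same integer serves for every `i`, so subtracting puts a difference of two `p`-th roots of
  -- unity in the sum of the ideals. That difference divides `p`, which is coprime to `l`.
  have hmem (i : ℕ) : z ^ v ^ i - ((ρ z).val : 𝓞 K) ∈ I i := by
    have h1 : z - ((ρ z).val : 𝓞 K) ∈ RingHom.ker ρ := by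
      rw [RingHom.mem_ker, map_sub, map_natCast, ZMod.natCast_zmod_val, sub_self]
    have h2 := Ideal.mem_map_of_mem (MulSemiringAction.toRingHom Gal(K/ℚ) (𝓞 K) (σ ^ i)) h1
    rw [map_sub, map_natCast, MulSemiringAction.toRingHom_apply, hσz] at h2
    exact h2
  have hlmem (i : ℕ) : (l : 𝓞 K) ∈ I i := by
    have h1 : (l : 𝓞 K) ∈ RingHom.ker ρ := by
      rw [RingHom.mem_ker, map_natCast, ZMod.natCast_self]
    have h2 := Ideal.mem_map_of_mem (MulSemiringAction.toRingHom Gal(K/ℚ) (𝓞 K) (σ ^ i)) h1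
    rwa [map_natCast] at h2
  rw [Ideal.isCoprime_iff_sup_eq, Ideal.eq_top_iff_one]
  change 1 ∈ I i ⊔ I j
  have hdiff : z ^ v ^ i - z ^ v ^ j ∈ I i ⊔ I j := by
    have h1 := (I i ⊔ I j).sub_mem (Ideal.mem_sup_left (hmem i)) (Ideal.mem_sup_right (hmem j))
    rwa [sub_sub_sub_cancel_right] at h1
  have hne : z ^ v ^ i ≠ z ^ v ^ j := fun h => hij <| by
    have h1 : ζ ^ v ^ i = ζ ^ v ^ j := congrArg (algebraMap (𝓞 K) K) h
    rw [root_pow_eq_pow_iff hζ] at h1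
    push_cast at h1
    exact hv.pow_inj hi hj h1
  have hroot (n : ℕ) : z ^ n ∈ Polynomial.nthRootsFinset p (1 : 𝓞 K) := by
    rw [Polynomial.mem_nthRootsFinset hp.pos, ← pow_mul, mul_comm, pow_mul, hz.pow_eq_one, one_pow]
  have hassoc : Associated (z - 1) (z ^ v ^ i - z ^ v ^ j) :=
    hz.nthRootsFinset_pairwise_associated_sub_one_sub_of_prime hp (hroot _) (hroot _) hne
  have hpmem : (p : 𝓞 K) ∈ I i ⊔ I j :=
    Ideal.mem_of_dvd _ (hassoc.symm.dvd.trans hζ.toInteger_sub_one_dvd_prime') hdiff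
  obtain ⟨a, b, hab⟩ := ((Nat.coprime_primes hp hl).mpr hlp.symm).cast (R := 𝓞 K)
  rw [← hab]
  exact Ideal.add_mem _ (Ideal.mul_mem_left _ _ hpmem)
    (Ideal.mul_mem_left _ _ (Ideal.mem_sup_left (hlmem i)))

/-- By coprimality of the conjugate primes it suffices to treat each `I i ^ e i` separately.
Membership of `G` there is the hypothesis for `σ ^ (-i)`, which raises `ζ` to exactly the exponent
`e i` occurring in `P(σ)`. -/
theorem powP_dvd_pow (hζ : IsPrimitiveRoot ζ p) {v : ℕ}
    (hv : IsPrimitiveRoot (v : ZMod p) (p - 1)) {σ : Gal(K/ℚ)} (hσ : σ ζ = ζ ^ v)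
    {l : ℕ} (hl : l.Prime) (hlp : l ≠ p) (ρ : 𝓞 K →+* ZMod l) {A G : 𝓞 K}
    (hA : Ideal.span {A} = RingHom.ker ρ ^ p)
    (hG : ∀ (f : 𝓞 K →+* 𝓞 K) (t : ZMod p), t ≠ 0 → f hζ.toInteger = hζ.toInteger ^ t.val →
      f G ∈ RingHom.ker ρ ^ t.val) :
    powP p v σ A ∣ G ^ p := by
  have hp : p.Prime := Fact.out
  have : NeZero p := ⟨hp.ne_zero⟩
  have hv0 : (v : ZMod p) ≠ 0 := hv.ne_zero (by have := hp.two_le; omega)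
  have hz := hζ.toInteger_isPrimitiveRoot
  set I := fun i : ℕ =>
    (RingHom.ker ρ).map (MulSemiringAction.toRingHom Gal(K/ℚ) (𝓞 K) (σ ^ i)) with hI
  set e := fun i : ℕ => ((v : ZMod p) ^ (-(i : ℤ))).val with he
  rw [← Ideal.mem_span_singleton, ← Ideal.dvd_span_singleton]
  have hspan : Ideal.span {powP p v σ A} = (∏ i ∈ Finset.range (p - 1), I i ^ e i) ^ p := by
    rw [powP, ← Ideal.prod_span_singleton, ← Finset.prod_pow]
    refine Finset.prod_congr rfl fun i _ => ?_
    have h1 : Ideal.span {(σ ^ i) • A} = I i ^ p := by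
      rw [hI, ← Ideal.map_pow, ← hA, Ideal.map_span, Set.image_singleton]
      rfl
    rw [← Ideal.span_singleton_pow, h1, ← pow_mul, ← pow_mul, mul_comm]
  rw [hspan, ← Ideal.span_singleton_pow]
  refine pow_dvd_pow_of_dvd (Finset.prod_dvd_of_coprime (fun i hi j hj hij => ?_) fun i _ => ?_) p
  · exact IsCoprime.pow (isCoprime_map_gal_pow hζ hv hσ hl hlp ρ (by simpa using hi)
      (by simpa using hj) hij)
  · rw [Ideal.dvd_span_singleton, hI, ← Ideal.map_pow]
    have hinv : ((σ ^ i)⁻¹) • hζ.toInteger = hζ.toInteger ^ e i := by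
      rw [inv_smul_eq_iff, smul_pow']
      refine RingOfIntegers.coe_injective ?_
      change ζ = ((σ ^ i) ζ) ^ e i
      rw [pow_apply_root hσ, ← pow_mul]
      conv_lhs => rw [← pow_one ζ]
      rw [root_pow_eq_pow_iff hζ]
      push_cast
      rw [he, ZMod.natCast_zmod_val, zpow_neg, zpow_natCast, mul_inv_cancel₀ (pow_ne_zero _ hv0)]
    have h1 := hG (MulSemiringAction.toRingHom Gal(K/ℚ) (𝓞 K) (σ ^ i)⁻¹) _
      (zpow_ne_zero (-(i : ℤ)) hv0) hinv
    have h2 := Ideal.mem_map_of_mem (MulSemiringAction.toRingHom Gal(K/ℚ) (𝓞 K) (σ ^ i)) h1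
    rwa [MulSemiringAction.toRingHom_apply, MulSemiringAction.toRingHom_apply, smul_inv_smul] at h2

/-- An integer whose product with its complex conjugate squares to `1` is a root of unity. -/
theorem exists_eq_neg_root_pow (hp : Odd p) (hζ : IsPrimitiveRoot ζ p) {conj : Gal(K/ℚ)}
    (hconj : conj ζ = ζ⁻¹) {u : 𝓞 K} (hu : (u * conj • u) ^ 2 = 1) :
    ∃ k : ℕ, (u : K) = (-ζ) ^ k := by
  have : NeZero p := ⟨(Fact.out : p.Prime).ne_zero⟩
  have habs (φ : K →+* ℂ) : ‖φ u‖ = 1 := by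
    have h1 : φ (((u : K) * conj (u : K)) ^ 2) = 1 := by
      have h2 : ((u : K) * conj (u : K)) ^ 2 = 1 := congrArg (algebraMap (𝓞 K) K) hu
      rw [h2, map_one]
    rw [map_pow, map_mul, embedding_apply_conj hζ hconj] at h1
    have h2 := congrArg norm h1
    rw [norm_pow, norm_mul, norm_star, norm_one, ← pow_two, ← pow_mul] at h2
    exact (pow_eq_one_iff_of_nonneg (norm_nonneg _) (by norm_num)).mp h2
  obtain ⟨n, hn, hun⟩ := NumberField.Embeddings.pow_eq_one_of_norm_eq_one K ℂ u.isIntegral_coe habs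
  exact hζ.exists_neg_pow_of_isOfFinOrder hp (isOfFinOrder_iff_pow_eq_one.mpr ⟨n, hn, hun⟩)

/-- If `u = z ^ k`, then `z - 1` would divide `2`. If `u = -z ^ k`, then `(z ^ k - 1) / (z - 1) ≡ k`
modulo `z - 1`, so the square in the hypothesis forces `p ∣ k`. -/
theorem eq_neg_one_of_sub_one_sq_dvd (hp : Odd p) (hζ : IsPrimitiveRoot ζ p) {u : 𝓞 K} {k : ℕ}
    (hu : (u : K) = (-ζ) ^ k) [NeZero p] (h : (hζ.toInteger - 1) ^ 2 ∣ u + 1) : u = -1 := by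
  have hp' : p.Prime := Fact.out
  have hp2 : 2 < p := by
    have := hp'.two_le
    obtain ⟨c, rfl⟩ := hp
    omega
  have hz := hζ.toInteger_isPrimitiveRoot
  have hprime := hζ.zeta_sub_one_prime'
  have hu' : u = (-hζ.toInteger) ^ k := RingOfIntegers.coe_injective (by simpa using! hu)
  have h2 := IsCyclotomicExtension.Rat.two_not_mem_span_zeta_sub_one' p hζ hp2
  rw [Ideal.mem_span_singleton] at h2
  set z := hζ.toInteger
  rw [neg_pow] at hu'
  obtain ⟨s, hs⟩ : ∃ s : 𝓞 K, z ^ k - 1 = (z - 1) * s ∧ z - 1 ∣ s - k := by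
    refine ⟨∑ i ∈ Finset.range k, z ^ i, (mul_geom_sum _ _).symm, ?_⟩
    have h1 : ∑ i ∈ Finset.range k, z ^ i - (k : 𝓞 K) = ∑ i ∈ Finset.range k, (z ^ i - 1) := by
      simp
    rw [h1]
    exact Finset.dvd_sum fun i _ => by simpa using sub_dvd_pow_sub_pow z 1 i
  rcases neg_one_pow_eq_or (𝓞 K) k with hk | hk
  · rw [hk, one_mul] at hu'
    refine absurd ?_ h2
    have h3 : (2 : 𝓞 K) = u + 1 - (z - 1) * s := by rw [hu', ← hs.1]; ring
    rw [h3]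
    exact dvd_sub ((dvd_pow_self _ two_ne_zero).trans h) (Dvd.intro _ rfl)
  · rw [hk] at hu'
    have h3 : u + 1 = (z - 1) * (-s) := by rw [hu', mul_neg, ← hs.1]; ring
    rw [h3, pow_two, mul_dvd_mul_iff_left hprime.ne_zero, dvd_neg] at h
    have h4 : z - 1 ∣ (k : 𝓞 K) := by
      have := dvd_sub h hs.2
      rwa [sub_sub_cancel] at this
    have h5 : p ∣ k := by
      have := (IsCyclotomicExtension.Rat.zeta_sub_one_dvd_intCast_iff' p hζ (n := k)).mp
        (by simpa using h4)
      exact_mod_cast this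
    obtain ⟨c, rfl⟩ := h5
    rw [hu', pow_mul, hz.pow_eq_one, one_pow, mul_one]

end

/-! ### The main theorem -/

theorem theoreml512164 (p : ℕ) [Fact p.Prime] (hp : Odd p)
    (K : Type*) [Field K] [NumberField K] [IsCyclotomicExtension {p} ℚ K]
    (ζ : K) (hζ : IsPrimitiveRoot ζ p)
    -- a primitive root `v` modulo `p`, with `σ : ζ ↦ ζ ^ v`, and complex conjugation `conj`
    (v : ℕ) (hv : IsPrimitiveRoot (v : ZMod p) (p - 1))
    (σ : Gal(K/ℚ)) (hσ : σ ζ = ζ ^ v)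
    (conj : Gal(K/ℚ)) (hconj : conj ζ = ζ⁻¹)
    -- `p` does not divide the class number of the maximal real subfield
    (hplus : ¬ p ∣ classNumber (maximalRealSubfield K))
    -- a subgroup of order `p` of the class group annihilated by `σ - μ`, `μ = v ^ (2 m + 1)`
    (m : ℕ) (hm1 : 1 ≤ m) (hm2 : m ≤ (p - 3) / 2)
    (μ : (ZMod p)ˣ) (hμ : (μ : ZMod p) = (v : ZMod p) ^ (2 * m + 1))
    (Γ : Subgroup (ClassGroup (𝓞 K))) (hΓ : Nat.card Γ = p) (hΓμ : AnnihilatedBySub Γ σ μ)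
    -- a prime ideal of inertial degree `1` with class in `Γ`
    (𝔮 : (Ideal (𝓞 K))⁰) (hprime : (𝔮 : Ideal (𝓞 K)).IsPrime)
    (hdeg : (Ideal.absNorm (𝔮 : Ideal (𝓞 K))).Prime) (hclass : ClassGroup.mk0 𝔮 ∈ Γ)
    -- a singular integer `A` with `(A) = 𝔮 ^ p`, `π ^ (2 m + 1) ∥ A - 1`, `A * conj A = D ^ p`
    (A : 𝓞 K) (hA : IsSingular p A) (hAq : Ideal.span {A} = (𝔮 : Ideal (𝓞 K)) ^ p)
    (hdvd : A - 1 ∈ cycloPi hζ ^ (2 * m + 1)) (hndvd : A - 1 ∉ cycloPi hζ ^ (2 * m + 2))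
    (D : 𝓞 (maximalRealSubfield K))
    (hD : A * conj • A = algebraMap (𝓞 (maximalRealSubfield K)) (𝓞 K) D ^ p) :
    powP p v σ A - 1 ∈ cycloPi hζ ^ (2 * (p - 1)) := by 
  have hp' : p.Prime := Fact.out
  have hp2 := hp'.two_le
  have : NeZero p := ⟨hp'.ne_zero⟩
  set z := hζ.toInteger with hz_def
  have hz : IsPrimitiveRoot z p := hζ.toInteger_isPrimitiveRoot
  obtain ⟨l, hl⟩ : ∃ l, Ideal.absNorm (𝔮 : Ideal (𝓞 K)) = l := ⟨_, rfl⟩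
  rw [hl] at hdeg
  have : Fact l.Prime := ⟨hdeg⟩
  obtain ⟨ρ, hρ⟩ := exists_ringHom_zmod_ker_eq hdeg hl
  have hAq' : Ideal.span {A} = RingHom.ker ρ ^ p := by rw [hρ, hAq]
  have hA1 : (z - 1) ^ (2 * m + 1) ∣ A - 1 := by
    rwa [cycloPi, Ideal.span_singleton_pow, Ideal.mem_span_singleton] at hdvd
  have hρA : ρ A = 0 := by
    have h1 : A ∈ RingHom.ker ρ ^ p := hAq' ▸ Ideal.mem_span_singleton_self A
    exact Ideal.pow_le_self hp'.ne_zero h1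
  -- Otherwise `z - 1`, and with it `A - 1`, would lie in `𝔮`, which contains `A`. Thus `𝔮` does not
  -- lie above `p`.
  have hρz : ρ z ≠ 1 := fun h => by
    obtain ⟨c, hc⟩ := (dvd_pow_self (z - 1) (by omega : 2 * m + 1 ≠ 0)).trans hA1
    have h1 := congrArg ρ hc
    rw [map_sub, hρA, map_mul, map_sub, h, map_one, sub_self, zero_mul, zero_sub] at h1
    exact one_ne_zero (neg_eq_zero.mp h1)
  have hord : orderOf (ρ z) = p :=
    orderOf_eq_prime (by rw [← map_pow, hz.pow_eq_one, map_one]) hρz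
  have hpl : p ∣ l - 1 := by
    rw [← hord]
    refine ZMod.orderOf_dvd_card_sub_one fun h0 => ?_
    have := congrArg ρ hz.pow_eq_one
    rw [map_pow, h0, zero_pow hp'.ne_zero, map_one] at this
    exact zero_ne_one this
  have hlp : l ≠ p := by
    rintro rfl
    have := Nat.le_of_dvd (by omega) hpl
    omega
  obtain ⟨k, hk⟩ := hpl
  have hk' : Fintype.card (ZMod l) - 1 = p * k := by rw [ZMod.card, hk]
  obtain ⟨χ, hχ, hρχ⟩ := exists_mulChar_eq_pow hp' hk' ρ hz hρz
  have hχp : χ ^ p = 1 := hχ ▸ pow_orderOf_eq_one χ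
  set G := jacobiProd p χ with hG_def
  have hdiv : powP p v σ A ∣ G ^ p := powP_dvd_pow hζ hv hσ hdeg hlp ρ hAq' fun f t ht hf =>
    map_jacobiProd_mem_ker_pow hk' ρ hχp hρχ hz ht hf
  obtain ⟨u, hu⟩ := hdiv
  have hl0 : (l : 𝓞 K) ≠ 0 := Nat.cast_ne_zero.mpr hdeg.ne_zero
  have hconjz : conj • z = z ^ (p - 1) := by
    refine RingOfIntegers.coe_injective ?_
    change conj ζ = ζ ^ (p - 1)
    rw [hconj]
    refine inv_eq_of_mul_eq_one_right ?_
    rw [← pow_succ', Nat.sub_add_cancel hp'.one_le, hζ.pow_eq_one]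
  have hGG : G * conj • G = (l : 𝓞 K) ^ p := by
    have := jacobiProd_mul_map (K := K) hχ hz
      (f := MulSemiringAction.toRingHom Gal(K/ℚ) (𝓞 K) conj) hconjz
    rwa [ZMod.card] at this
  have hnorm : algebraMap ℤ (𝓞 K) (Algebra.norm ℤ A) ^ 2 = ((l : 𝓞 K) ^ p) ^ 2 := by
    have h1 : (Algebra.norm ℤ A).natAbs = l ^ p := by
      rw [← Ideal.absNorm_span_singleton, hAq, map_pow, hl]
    have h2 : Algebra.norm ℤ A ^ 2 = ((l : ℤ) ^ p) ^ 2 := by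
      rw [← Int.natAbs_sq, h1]
      push_cast
      rfl
    rw [← map_pow, h2]
    simp
  have hPP := powP_mul_conj_sq hp hζ hv hσ hconj hD
  rw [hnorm] at hPP
  have huu : (u * conj • u) ^ 2 = 1 := by
    have h1 : ((G * conj • G) ^ p) ^ 2 =
        (powP p v σ A * conj • powP p v σ A) ^ 2 * (u * conj • u) ^ 2 := by
      rw [mul_pow, ← smul_pow', hu, smul_mul']
      ring
    rw [hPP, hGG, ← pow_mul, ← pow_mul, ← pow_mul, ← pow_mul, mul_comm 2 p] at h1
    exact (mul_eq_left₀ (pow_ne_zero _ hl0)).mp h1.symm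
  obtain ⟨r, hr⟩ := exists_eq_neg_root_pow hp hζ hconj huu
  have hπp : (z - 1) ^ (p - 1) ∣ (p : 𝓞 K) := by
    obtain ⟨c, -, hc⟩ := hz.self_sub_one_pow_dvd_order (k := p - 1) (by omega)
    exact ⟨c, by rw [hc, mul_comm]⟩
  have hG1 : (z - 1) ^ (p + (p - 1)) ∣ G ^ p + 1 :=
    dvd_pow_prime_add_one hp' hp hp'.one_le hπp (sub_one_pow_dvd_jacobiProd_add_one hp hχ hz)
  -- Each conjugate of `A` is `1` modulo `π ^ 2`, since `2 ≤ 2 * m + 1` and the Galois action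
  -- preserves `π`.
  have hP1 : (z - 1) ^ 2 ∣ powP p v σ A - 1 := by
    have h1 (τ : Gal(K/ℚ)) (hτ : ∃ n : ℕ, τ • z = z ^ n) : (z - 1) ^ 2 ∣ τ • A - 1 := by
      obtain ⟨n, hn⟩ := hτ
      obtain ⟨c, hc⟩ := (pow_dvd_pow (z - 1) (by omega : 2 ≤ 2 * m + 1)).trans hA1
      have h2 := congrArg (τ • ·) hc
      simp only [smul_sub, smul_one, smul_mul', smul_pow', hn] at h2
      rw [h2]
      exact Dvd.dvd.mul_right (pow_dvd_pow_of_dvd (by simpa using sub_dvd_pow_sub_pow z 1 n) 2) _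
    have h3 : Ideal.Quotient.mk (Ideal.span {(z - 1) ^ 2}) (powP p v σ A) = 1 := by
      rw [powP, map_prod]
      refine Finset.prod_eq_one fun i _ => ?_
      have h4 : Ideal.Quotient.mk (Ideal.span {(z - 1) ^ 2}) ((σ ^ i) • A) = 1 := by
        rw [← map_one (Ideal.Quotient.mk (Ideal.span {(z - 1) ^ 2})), Ideal.Quotient.eq,
          Ideal.mem_span_singleton]
        exact h1 _ ⟨v ^ i, RingOfIntegers.coe_injective (pow_apply_root hσ i)⟩
      rw [map_pow, h4, one_pow]
    rwa [← map_one (Ideal.Quotient.mk (Ideal.span {(z - 1) ^ 2})), Ideal.Quotient.eq,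
      Ideal.mem_span_singleton] at h3
  have hu1 : u = -1 := by
    refine eq_neg_one_of_sub_one_sq_dvd hp hζ hr ?_
    have h1 : u + 1 = (G ^ p + 1) - (powP p v σ A - 1) * u := by rw [hu]; ring
    rw [h1]
    exact dvd_sub ((pow_dvd_pow _ (by omega)).trans hG1) (hP1.mul_right _)
  rw [cycloPi, Ideal.span_singleton_pow, Ideal.mem_span_singleton]
  have h1 : powP p v σ A - 1 = -(G ^ p + 1) := by rw [hu, hu1]; ring
  rw [h1, dvd_neg]
  -- The exponent obtained, `2p - 1`, is one more than required.
  exact (pow_dvd_pow _ (by omega)).trans hG1
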